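/- Let $K$ and $L$ be topological fields, that is, fields with a Hausdorff topology for which addition, multiplication, and inversion on the non-zero elements are continuous. Let $X$ and $Y$ be vector spaces over $K$ and $L$, respectively, of possibly infinite dimension, with $\dim_K X\ge 3$. A vector topology on $X$ is a (not necessarily Hausdorff) topology for which addition $X\times X\to X$ and scalar multiplication $K\times X\to X$ are continuous. Let $\tau_K(X)$ be the lattice of all vector topologies on $X$, ordered by inclusion of the families of open sets, and let $\tau_K^H(X)\subseteq\tau_K(X)$ be the set of Hausdorff ones; define $\tau_L(Y)$ and $\tau_L^H(Y)$ in the same way. Suppose that there is a lattice isomorphism $\Phi:\tau_K(X)\to\tau_L(Y)$ with $\Phi(\tau_K^H(X))=\tau_L^H(Y)$. Then $K$ and $L$ are isomorphic as fields, and $\dim_K X=\dim_L Y$ as cardinal numbers. The fields need not be isomorphic as topological fields: there exist $K,L,X,Y$ and $\Phi$ as above such that no field isomorphism $K\to L$ is a homeomorphism. -/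

import Mathlib

open Topology

universe u v w z

/-- A vector topology on the vector space `X` over the topological field `K`: a (possibly
non-Hausdorff) topology for which addition `X × X → X` and scalar multiplication `K × X → X`
are continuous. -/
@[ext]
structure VectorTopology (K : Type u) (X : Type v) [Field K] [TopologicalSpace K]
    [AddCommGroup X] [Module K X] where
  /-- the underlying topology -/
  topology : TopologicalSpace X
  continuousAdd : @ContinuousAdd X topology _
  continuousSMul : @ContinuousSMul K X _ _ topology

namespace VectorTopology

/-- Vector topologies are ordered by inclusion of their families of open sets: `S ≤ T` when every
`S`-open set is `T`-open. (This is opposite to Mathlib's order on `TopologicalSpace X`.) -/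
instance instPartialOrder (K : Type u) (X : Type v) [Field K] [TopologicalSpace K]
    [AddCommGroup X] [Module K X] : PartialOrder (VectorTopology K X) where
  le S T := ∀ U : Set X, IsOpen[S.topology] U → IsOpen[T.topology] U
  le_refl _ _ h := h
  le_trans _ _ _ h₁ h₂ U hU := h₂ U (h₁ U hU)
  le_antisymm _ _ h₁ h₂ :=
    VectorTopology.ext (TopologicalSpace.ext (funext fun U => propext ⟨h₁ U, h₂ U⟩))

/-- The topology generated by the union of a family of vector topologies. -/
instance instSupSet (K : Type u) (X : Type v) [Field K] [TopologicalSpace K]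
    [AddCommGroup X] [Module K X] : SupSet (VectorTopology K X) where
  sSup A :=
    { topology := sInf (topology '' A)
      continuousAdd := continuousAdd_sInf (by
        rintro _ ⟨T, _, rfl⟩
        exact T.continuousAdd)
      continuousSMul := continuousSMul_sInf (by
        rintro _ ⟨T, _, rfl⟩
        exact T.continuousSMul) }

/-- The vector topologies form a complete lattice. Hence a lattice isomorphism between two such
lattices is the same as an order isomorphism. -/
noncomputable instance instCompleteLattice (K : Type u) (X : Type v) [Field K]
    [TopologicalSpace K] [AddCommGroup X] [Module K X] : CompleteLattice (VectorTopology K X) :=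
  completeLatticeOfSup (VectorTopology K X) fun A =>
    ⟨fun T hT => (sInf_le (Set.mem_image_of_mem topology hT) :
        sInf (topology '' A) ≤ T.topology),
      fun T hT => (le_sInf (by
        rintro _ ⟨S, hS, rfl⟩
        exact hT hS) : T.topology ≤ sInf (topology '' A))⟩

/-- The set of Hausdorff vector topologies. -/
def hausdorff (K : Type u) (X : Type v) [Field K] [TopologicalSpace K]
    [AddCommGroup X] [Module K X] : Set (VectorTopology K X) :=
  {T | @T2Space X T.topology}

end VectorTopology

/-!
Let `T.core` denote the closure of `{0}` in a vector topology `T`. It is a subspace, it is zero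
exactly when `T` is Hausdorff, and the closure of zero in a join is the intersection of the two
closures (`VectorTopology.core_sup`). Every subspace `M` occurs as a closure of zero, for the
topology defined by the linear functionals that vanish on `M` (`VectorTopology.core_weak`); this
uses only that the field is Hausdorff. Hence `S.core ≤ T.core` holds exactly when every topology
whose join with `T` is Hausdorff has a Hausdorff join with `S` (`VectorTopology.core_le_core_iff`):
if `x` lies in `S.core` but not in `T.core`, a topology with core `K ∙ x` tells the difference. This
condition is expressed by the lattice and its Hausdorff elements, so `Φ` induces an isomorphism of
the lattices of subspaces (`VectorTopology.submoduleOrderIso`). The fundamental theorem of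
projective geometry, in the form of `Submodule.nonempty_ringEquiv_of_orderIso`, gives the
isomorphism of fields; the equality of dimensions holds because independent families of lines that
span the space are preserved.

For the second assertion, a vector topology on a finite-dimensional space over a complete
nontrivially normed field is determined by the closure of zero, so its lattice of vector topologies
is the dual of the lattice of subspaces (`VectorTopology.coreOrderIso`) and depends only on the
abstract field. The fields `ℂ` and `ℂ_[2]` are both algebraically closed of characteristic zero and
of the cardinality of the continuum, hence abstractly isomorphic, but one is connected and the other
totally disconnected.
-/

/-! ### Order isomorphisms between lattices of subspaces -/

namespace Submodule

variable {K : Type u} {L : Type v} {X : Type w} {Y : Type z} [Field K] [Field L]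
  [AddCommGroup X] [Module K X] [AddCommGroup Y] [Module L Y]
  (φ : Submodule K X ≃o Submodule L Y)

theorem exists_orderIso_span_singleton {x : X} (hx : x ≠ 0) :
    ∃ y : Y, φ (K ∙ x) = L ∙ y := by
  have h : IsAtom (φ (K ∙ x)) := (φ.isAtom_iff _).2 (nonzero_span_atom x hx)
  obtain ⟨y, -, hy⟩ := (atom_iff_nonzero_span _).1 h
  exact ⟨y, hy⟩

variable {φ}

theorem ne_zero_of_orderIso_span {x : X} {y : Y} (hx : x ≠ 0) (h : φ (K ∙ x) = L ∙ y) :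
    y ≠ 0 := by
  rintro rfl
  rw [span_zero_singleton, map_eq_bot_iff, span_singleton_eq_bot] at h
  exact hx h

/-- An order isomorphism of subspace lattices preserves collinearity of points. -/
theorem mem_span_pair_of_orderIso {x x' z : X} {y y' t : Y} (h : φ (K ∙ x) = L ∙ y)
    (h' : φ (K ∙ x') = L ∙ y') (hz : φ (K ∙ z) = L ∙ t) (hmem : z ∈ span K {x, x'}) :
    t ∈ span L {y, y'} := by
  rw [← span_singleton_le_iff_mem, span_insert] at hmem ⊢
  rw [← h, ← h', ← hz, ← φ.map_sup]
  exact φ.monotone hmem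

theorem linearIndependent_of_orderIso {ι : Type*} {b : ι → X} {c : ι → Y}
    (hb : LinearIndependent K b) (h : ∀ i, φ (K ∙ b i) = L ∙ c i) : LinearIndependent L c := by
  have hi : iSupIndep fun i => φ (K ∙ b i) := hb.iSupIndep_span_singleton.map_orderIso φ
  refine iSupIndep.linearIndependent _ hi (fun i => ?_)
    fun i => ne_zero_of_orderIso_span (hb.ne_zero i) (h i)
  simp only [h]
  exact mem_span_singleton_self _

/-- Vector spaces with isomorphic lattices of subspaces have the same dimension: the lines spanned
by a basis correspond to the lines spanned by a basis. -/
theorem lift_rank_eq_of_orderIso (φ : Submodule K X ≃o Submodule L Y) :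
    Cardinal.lift.{z} (Module.rank K X) = Cardinal.lift.{w} (Module.rank L Y) := by
  let b := Module.Basis.ofVectorSpace K X
  choose c hc using fun i => exists_orderIso_span_singleton φ (b.ne_zero i)
  have hli : LinearIndependent L c := linearIndependent_of_orderIso b.linearIndependent hc
  have hsp : ⊤ ≤ span L (Set.range c) := by
    rw [span_range_eq_iSup]
    simp only [← hc]
    rw [← φ.map_iSup, ← span_range_eq_iSup, b.span_eq, OrderIso.map_top]
  let c' := Module.Basis.mk hli hsp
  rw [← b.mk_eq_rank'', ← Cardinal.lift_inj.{max w z, max w z}]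
  have := c'.mk_eq_rank
  simpa using congrArg Cardinal.lift.{max w z} this

/-- The points of the line through `x` and `x'` other than `x'` itself correspond to points of the
same affine form. -/
theorem exists_orderIso_span_add_smul {x x' : X} {y y' : Y} (hx : x ∉ K ∙ x')
    (h : φ (K ∙ x) = L ∙ y) (h' : φ (K ∙ x') = L ∙ y') (a : K) :
    ∃ c : L, φ (K ∙ (x + a • x')) = L ∙ (y + c • y') := by
  have hnot : x + a • x' ∉ K ∙ x' := fun hmem => hx <| by
    simpa using sub_mem hmem (smul_mem _ a (mem_span_singleton_self x'))
  obtain ⟨t, ht⟩ := exists_orderIso_span_singleton φ (x := x + a • x') fun h0 =>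
    hnot (h0 ▸ zero_mem _)
  have hmem := mem_span_pair_of_orderIso h h' ht
    (mem_span_pair.2 ⟨1, a, by rw [one_smul]⟩)
  obtain ⟨p, q, rfl⟩ := mem_span_pair.1 hmem
  have hp : p ≠ 0 := by
    rintro rfl
    refine hnot ?_
    rw [← span_singleton_le_iff_mem, ← φ.le_iff_le, ht, h', span_singleton_le_iff_mem, zero_smul,
      zero_add]
    exact smul_mem _ _ (mem_span_singleton_self _)
  refine ⟨p⁻¹ * q, ?_⟩
  rw [ht, ← span_singleton_smul_eq (IsUnit.mk0 p hp) (y + _)]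
  congr 2
  rw [smul_add, smul_smul, mul_inv_cancel_left₀ hp]

/-- A representative of the image of `K ∙ x'` can be scaled so that the unit point of the line
through `x` and `x'` goes to the unit point. -/
theorem exists_orderIso_span_add {x x' : X} {y : Y} (hx : x ∉ K ∙ x') (hx' : x' ∉ K ∙ x)
    (h : φ (K ∙ x) = L ∙ y) :
    ∃ y' : Y, φ (K ∙ x') = L ∙ y' ∧ φ (K ∙ (x + x')) = L ∙ (y + y') := by
  obtain ⟨t, ht⟩ := exists_orderIso_span_singleton φ (x := x') fun h0 => hx' (h0 ▸ zero_mem _)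
  obtain ⟨c, hc⟩ := exists_orderIso_span_add_smul hx h ht 1
  rw [one_smul] at hc
  have hc0 : c ≠ 0 := by
    rintro rfl
    rw [zero_smul, add_zero, ← h] at hc
    have := mem_span_singleton_self (R := K) (x + x')
    rw [φ.injective hc] at this
    exact hx' (by simpa using sub_mem this (mem_span_singleton_self x))
  exact ⟨c • t, by rw [ht, span_singleton_smul_eq (IsUnit.mk0 c hc0)], hc⟩

theorem notMem_span_singleton_of_ne {ι : Type*} {b : ι → X} (hb : LinearIndependent K b) {i j : ι}
    (h : i ≠ j) : b i ∉ K ∙ b j := by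
  simpa using hb.notMem_span_image (s := {j}) (x := i) (by simpa using h)

theorem coeff_eq_zero {f₀ f₁ f₂ : Y} (hf : LinearIndependent L ![f₀, f₁, f₂]) {a b c : L}
    (h : a • f₀ + b • f₁ + c • f₂ = 0) : a = 0 ∧ b = 0 ∧ c = 0 := by
  have := Fintype.linearIndependent_iff.1 hf ![a, b, c] (by simpa [Fin.sum_univ_three] using h)
  exact ⟨this 0, this 1, this 2⟩

/-- The part of the fundamental theorem of projective geometry that concerns scalars. The points
`K ∙ (e₀ + a • e₁)` of a line correspond to points `L ∙ (f₀ + σ a • f₁)`, and `σ` is additive and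
multiplicative because sums and products of scalars are constructed in the projective plane
on `e₀, e₁, e₂` by joining and intersecting lines. -/
theorem nonempty_ringEquiv_of_orderIso (φ : Submodule K X ≃o Submodule L Y) {e₀ e₁ e₂ : X}
    (he : LinearIndependent K ![e₀, e₁, e₂]) : Nonempty (K ≃+* L) := by
  have h01 : e₀ ∉ K ∙ e₁ := notMem_span_singleton_of_ne he (i := 0) (j := 1) (by decide)
  have h10 : e₁ ∉ K ∙ e₀ := notMem_span_singleton_of_ne he (i := 1) (j := 0) (by decide)
  have h02 : e₀ ∉ K ∙ e₂ := notMem_span_singleton_of_ne he (i := 0) (j := 2) (by decide)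
  have h20 : e₂ ∉ K ∙ e₀ := notMem_span_singleton_of_ne he (i := 2) (j := 0) (by decide)
  obtain ⟨f₀, H0⟩ := exists_orderIso_span_singleton φ (he.ne_zero 0)
  obtain ⟨f₁, H1, H01⟩ := exists_orderIso_span_add h01 h10 H0
  obtain ⟨f₂, H2, H02⟩ := exists_orderIso_span_add h02 h20 H0
  simp only [Matrix.cons_val_zero] at H0
  have hf : LinearIndependent L ![f₀, f₁, f₂] := linearIndependent_of_orderIso he fun i => by
    fin_cases i
    exacts [H0, H1, H2]
  choose σ hσ using exists_orderIso_span_add_smul h01 H0 H1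
  choose τ hτ using exists_orderIso_span_add_smul h02 H0 H2
  -- two points of the line through `f₀` and `f₁` agree only if their coordinates do
  have huniq : ∀ {s t : L}, L ∙ (f₀ + s • f₁) = L ∙ (f₀ + t • f₁) → s = t := fun {s t} h => by
    have hm := mem_span_singleton_self (R := L) (f₀ + s • f₁)
    rw [h] at hm
    obtain ⟨r, hr⟩ := mem_span_singleton.1 hm
    obtain ⟨h0, h1, -⟩ := coeff_eq_zero hf (a := r - 1) (b := r * t - s) (c := 0)
      (by linear_combination (norm := module) hr)
    linear_combination t * h0 - h1
  have σ_zero : σ 0 = 0 := huniq (by rw [← hσ, zero_smul, zero_smul, add_zero, add_zero, H0])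
  have σ_one : σ 1 = 1 := huniq (by rw [← hσ, one_smul, one_smul, H01])
  -- the point at infinity of the line of slope `-1`
  have H12 : φ (K ∙ (e₁ - e₂)) = L ∙ (f₁ - f₂) := by
    obtain ⟨t, ht⟩ := exists_orderIso_span_singleton φ (x := e₁ - e₂) fun h0 =>
      one_ne_zero (coeff_eq_zero he (a := 0) (b := 1) (c := -1)
        (by linear_combination (norm := module) h0)).2.1
    obtain ⟨a, b, hab⟩ := mem_span_pair.1 (mem_span_pair_of_orderIso H1 H2 ht
      (mem_span_pair.2 ⟨1, -1, by module⟩))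
    obtain ⟨c, d, hcd⟩ := mem_span_pair.1 (mem_span_pair_of_orderIso H01 H02 ht
      (mem_span_pair.2 ⟨1, -1, by module⟩))
    obtain ⟨h0, h1, h2⟩ := coeff_eq_zero hf (a := c + d) (b := c - a) (c := d - b)
      (by linear_combination (norm := module) hcd - hab)
    have hb : b = -a := by linear_combination h0 - h1 - h2
    have ha : a ≠ 0 := by
      rintro rfl
      refine ne_zero_of_orderIso_span (fun h0 => ?_) ht (by rw [← hab, hb]; simp)
      exact one_ne_zero (coeff_eq_zero he (a := 0) (b := 1) (c := -1)
        (by linear_combination (norm := module) h0)).2.1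
    rw [ht, ← span_singleton_smul_eq (IsUnit.mk0 a ha) (f₁ - f₂), ← hab, hb]
    congr 2
    module
  have τσ : ∀ a, τ a = σ a := fun a => by
    have hmem : e₀ + a • e₂ ∈ span K {e₀ + a • e₁, e₁ - e₂} :=
      mem_span_pair.2 ⟨1, -a, by module⟩
    obtain ⟨c, d, hcd⟩ := mem_span_pair.1 (mem_span_pair_of_orderIso (hσ a) H12 (hτ a) hmem)
    obtain ⟨h0, h1, h2⟩ := coeff_eq_zero hf (a := c - 1) (b := c * σ a + d) (c := -d - τ a)
      (by linear_combination (norm := module) hcd)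
    linear_combination σ a * h0 - h1 - h2
  -- points of the affine plane are determined by their two coordinates
  have hpt : ∀ a b, φ (K ∙ (e₀ + a • e₁ + b • e₂)) = L ∙ (f₀ + σ a • f₁ + σ b • f₂) :=
      fun a b => by
    obtain ⟨t, ht⟩ := exists_orderIso_span_singleton φ (x := e₀ + a • e₁ + b • e₂) fun h0 =>
      one_ne_zero (coeff_eq_zero he (a := 1) (b := a) (c := b)
        (by linear_combination (norm := module) h0)).1
    have ht0 : t ≠ 0 := ne_zero_of_orderIso_span (fun h0 =>
      one_ne_zero (coeff_eq_zero he (a := 1) (b := a) (c := b)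
        (by linear_combination (norm := module) h0)).1) ht
    obtain ⟨p, q, hpq⟩ := mem_span_pair.1 (mem_span_pair_of_orderIso (hσ a) H2 ht
      (mem_span_pair.2 ⟨1, b, by module⟩))
    obtain ⟨r, s, hrs⟩ := mem_span_pair.1 (mem_span_pair_of_orderIso (hτ b) H1 ht
      (mem_span_pair.2 ⟨1, a, by module⟩))
    rw [τσ] at hrs
    obtain ⟨h0, h1, h2⟩ := coeff_eq_zero hf (a := p - r) (b := p * σ a - s)
      (c := q - r * σ b) (by linear_combination (norm := module) hpq - hrs)
    have hq : q = p * σ b := by linear_combination h2 - σ b * h0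
    have hp : p ≠ 0 := by
      rintro rfl
      refine ht0 ?_
      rw [← hpq, hq]
      simp
    rw [ht, ← span_singleton_smul_eq (IsUnit.mk0 p hp) (f₀ + σ a • f₁ + σ b • f₂), ← hpq, hq]
    congr 2
    module
  have σ_add : ∀ a b, σ (a + b) = σ a + σ b := fun a b => by
    have hmem : e₀ + (a + b) • e₁ ∈ span K {e₀ + a • e₁ + b • e₂, e₁ - e₂} :=
      mem_span_pair.2 ⟨1, b, by module⟩
    obtain ⟨c, d, hcd⟩ := mem_span_pair.1
      (mem_span_pair_of_orderIso (hpt a b) H12 (hσ (a + b)) hmem)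
    obtain ⟨h0, h1, h2⟩ := coeff_eq_zero hf (a := c - 1) (b := c * σ a + d - σ (a + b))
      (c := c * σ b - d) (by linear_combination (norm := module) hcd)
    linear_combination (σ a + σ b) * h0 - h1 - h2
  -- the point at infinity of the line of slope `b`
  have hslope : ∀ b, ∃ t, φ (K ∙ (e₁ + b • e₂)) = L ∙ t ∧ t ∈ span L {f₁ + σ b • f₂} :=
      fun b => by
    obtain ⟨t, ht⟩ := exists_orderIso_span_singleton φ (x := e₁ + b • e₂) fun h0 =>
      one_ne_zero (coeff_eq_zero he (a := 0) (b := 1) (c := b)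
        (by linear_combination (norm := module) h0)).2.1
    refine ⟨t, ht, ?_⟩
    obtain ⟨p, q, hpq⟩ := mem_span_pair.1 (mem_span_pair_of_orderIso H1 H2 ht
      (mem_span_pair.2 ⟨1, b, by module⟩))
    obtain ⟨r, s, hrs⟩ := mem_span_pair.1 (mem_span_pair_of_orderIso H0 (hpt 1 b) ht
      (mem_span_pair.2 ⟨-1, 1, by module⟩))
    rw [σ_one] at hrs
    obtain ⟨h0, h1, h2⟩ := coeff_eq_zero hf (a := r + s) (b := s - p) (c := s * σ b - q)
      (by linear_combination (norm := module) hrs - hpq)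
    have hq : q = p * σ b := by linear_combination σ b * h1 - h2
    exact mem_span_singleton.2 ⟨p, by rw [← hpq, hq]; module⟩
  have σ_mul : ∀ a b, σ (a * b) = σ a * σ b := fun a b => by
    obtain ⟨t, ht, htm⟩ := hslope b
    obtain ⟨r, rfl⟩ := mem_span_singleton.1 htm
    have hmem : e₀ + a • e₁ + (a * b) • e₂ ∈ span K {e₀, e₁ + b • e₂} :=
      mem_span_pair.2 ⟨1, a, by module⟩
    obtain ⟨c, d, hcd⟩ := mem_span_pair.1 (mem_span_pair_of_orderIso H0 ht (hpt a (a * b)) hmem)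
    obtain ⟨-, h1, h2⟩ := coeff_eq_zero hf (a := c - 1) (b := d * r - σ a)
      (c := d * r * σ b - σ (a * b)) (by linear_combination (norm := module) hcd)
    linear_combination σ b * h1 - h2
  let s : K →+* L :=
    { toFun := σ, map_zero' := σ_zero, map_one' := σ_one, map_add' := σ_add, map_mul' := σ_mul }
  refine ⟨RingEquiv.ofBijective s ⟨s.injective, fun c => ?_⟩⟩
  have hf01 : f₀ ∉ L ∙ f₁ := notMem_span_singleton_of_ne hf (i := 0) (j := 1) (by decide)
  obtain ⟨a, ha⟩ := exists_orderIso_span_add_smul (φ := φ.symm) hf01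
    (by rw [← H0, φ.symm_apply_apply]) (by rw [← H1, φ.symm_apply_apply]) c
  exact ⟨a, huniq ((hσ a).symm.trans (by rw [← ha, φ.apply_symm_apply]))⟩

theorem nonempty_ringEquiv_of_orderIso_of_three_le_rank (φ : Submodule K X ≃o Submodule L Y)
    (h : 3 ≤ Module.rank K X) : Nonempty (K ≃+* L) := by
  obtain ⟨s, hs, hli⟩ := le_rank_iff_exists_linearIndependent_finset.1
    (show ((3 : ℕ) : Cardinal) ≤ Module.rank K X from mod_cast h)
  obtain ⟨e, he⟩ : ∃ e : Fin 3 → X, LinearIndependent K e :=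
    ⟨_, hli.comp _ (s.equivFinOfCardEq hs).symm.injective⟩
  refine nonempty_ringEquiv_of_orderIso φ (e₀ := e 0) (e₁ := e 1) (e₂ := e 2) ?_
  convert he
  ext i
  fin_cases i <;> rfl

end Submodule

/-! ### The closure of zero in a vector topology -/

namespace VectorTopology

section Core

variable {K : Type u} {X : Type w} [Field K] [TopologicalSpace K] [AddCommGroup X] [Module K X]

theorem isTopologicalAddGroup (T : VectorTopology K X) :
    @IsTopologicalAddGroup X T.topology _ := by
  let := T.topology
  have := T.continuousAdd
  have := T.continuousSMul
  have : ContinuousNeg X := ⟨by simpa using continuous_const_smul (-1 : K) (T := X)⟩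
  exact ⟨⟩

/-- The subspace of the vectors lying in every neighbourhood of zero, that is, the closure
of `{0}`. -/
def core (T : VectorTopology K X) : Submodule K X where
  carrier := {x | pure x ≤ @nhds X T.topology 0}
  zero_mem' := @pure_le_nhds X T.topology 0
  add_mem' {x y} hx hy := by
    let := T.topology
    have := T.continuousAdd
    have h := (continuous_add (M := X)).tendsto (0, 0)
    rw [add_zero, nhds_prod_eq] at h
    simpa [Filter.Tendsto] using h.mono_left (Filter.prod_mono hx hy)
  smul_mem' c x hx := by
    let := T.topology
    have := T.continuousSMul
    have h := (continuous_const_smul c (T := X)).tendsto 0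
    rw [smul_zero] at h
    simpa [Filter.Tendsto] using h.mono_left hx

theorem mem_core {T : VectorTopology K X} {x : X} :
    x ∈ T.core ↔ pure x ≤ @nhds X T.topology 0 := Iff.rfl

theorem mem_hausdorff_iff {T : VectorTopology K X} : T ∈ hausdorff K X ↔ T.core = ⊥ := by
  let := T.topology
  have := T.isTopologicalAddGroup
  refine ⟨fun h => ?_, fun h => ?_⟩
  · have : T2Space X := h
    refine (Submodule.eq_bot_iff _).2 fun x hx => ?_
    exact pure_le_nhds_iff.1 hx
  · refine IsTopologicalAddGroup.t2Space_of_zero_sep fun x hx => ?_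
    have hx' : x ∉ T.core := by rwa [h, Submodule.mem_bot]
    rw [mem_core, Filter.le_def] at hx'
    push Not at hx'
    exact hx'

theorem core_anti {S T : VectorTopology K X} (h : S ≤ T) : T.core ≤ S.core :=
  fun _ hx => le_trans hx (nhds_mono (show T.topology ≤ S.topology from h))

theorem core_sup (S T : VectorTopology K X) : (S ⊔ T).core = S.core ⊓ T.core := by
  have h : (S ⊔ T).topology = S.topology ⊓ T.topology := by
    refine le_antisymm (le_inf (le_sup_left : S ≤ S ⊔ T) (le_sup_right : T ≤ S ⊔ T)) ?_
    change sInf (topology '' {S, T}) ≥ _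
    simp [Set.image_pair]
  ext x
  rw [Submodule.mem_inf, mem_core, mem_core, mem_core, h, nhds_inf, le_inf_iff]

/-- The inclusion of the closures of zero is expressed by joins and the Hausdorff property: it
suffices to test against topologies whose closure of zero is a given subspace. -/
theorem core_le_core_iff {S T : VectorTopology K X}
    (hex : ∀ M : Submodule K X, ∃ R : VectorTopology K X, R.core = M) :
    S.core ≤ T.core ↔ ∀ R, T ⊔ R ∈ hausdorff K X → S ⊔ R ∈ hausdorff K X := by
  simp only [mem_hausdorff_iff, core_sup]
  refine ⟨fun h R hR => le_bot_iff.1 (hR ▸ inf_le_inf_right _ h), fun h x hx => ?_⟩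
  by_contra hxT
  obtain ⟨R, hR⟩ := hex (K ∙ x)
  have h0 : x ≠ 0 := fun h0 => hxT (h0 ▸ zero_mem _)
  have hST := h R (by
    rw [hR, ← disjoint_iff, Submodule.disjoint_span_singleton' h0]
    exact hxT)
  have hm : x ∈ S.core ⊓ R.core := ⟨hx, hR ▸ Submodule.mem_span_singleton_self x⟩
  rw [hST, Submodule.mem_bot] at hm
  exact h0 hm

section weak

variable [IsTopologicalRing K]

/-- The coarsest topology for which all the linear functionals that vanish on `M` are
continuous. -/
def weak (M : Submodule K X) : VectorTopology K X where
  topology := ⨅ f : {f : X →ₗ[K] K // M ≤ LinearMap.ker f}, .induced f.1 inferInstance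
  continuousAdd := continuousAdd_iInf fun f => continuousAdd_induced f.1
  continuousSMul := continuousSMul_iInf fun f => continuousSMul_induced f.1

/-- A functional that vanishes on `M` but not at `x` separates `x` from zero. -/
theorem core_weak [T1Space K] (M : Submodule K X) : (weak M).core = M := by
  have key : ∀ x, x ∈ (weak M).core ↔ ∀ f : X →ₗ[K] K, M ≤ LinearMap.ker f → f x = 0 := by
    intro x
    rw [mem_core, weak, nhds_iInf, le_iInf_iff, Subtype.forall]
    refine forall₂_congr fun f _ => ?_
    rw [nhds_induced, map_zero, ← Filter.map_le_iff_le_comap, Filter.map_pure]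
    exact pure_le_nhds_iff
  ext x
  rw [key]
  refine ⟨fun h => ?_, fun hx f hf => hf hx⟩
  by_contra hx
  obtain ⟨f, hfx, hf⟩ := Submodule.exists_le_ker_of_notMem hx
  exact hfx (h f hf)

end weak

section OrderIso

variable {L : Type v} {Y : Type z} [Field L] [TopologicalSpace L] [AddCommGroup Y] [Module L Y]
  [IsTopologicalRing K] [T1Space K] [IsTopologicalRing L] [T1Space L]

theorem core_map_le_core_map_iff (Φ : VectorTopology K X ≃o VectorTopology L Y)
    (hΦ : Φ '' hausdorff K X = hausdorff L Y) {S T : VectorTopology K X} :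
    (Φ S).core ≤ (Φ T).core ↔ S.core ≤ T.core := by
  have hmem : ∀ R, Φ R ∈ hausdorff L Y ↔ R ∈ hausdorff K X := fun R => by
    rw [← hΦ, Φ.injective.mem_set_image]
  rw [core_le_core_iff fun M => ⟨weak M, core_weak M⟩,
    core_le_core_iff fun M => ⟨weak M, core_weak M⟩, Φ.surjective.forall]
  simp only [← Φ.map_sup, hmem]

/-- An isomorphism of lattices of vector topologies that preserves the Hausdorff ones induces an
isomorphism of the lattices of subspaces. -/
def submoduleOrderIso (Φ : VectorTopology K X ≃o VectorTopology L Y)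
    (hΦ : Φ '' hausdorff K X = hausdorff L Y) : Submodule K X ≃o Submodule L Y where
  toFun M := (Φ (weak M)).core
  invFun N := (Φ.symm (weak N)).core
  left_inv M := by
    conv_rhs => rw [← core_weak M]
    apply le_antisymm <;>
    · rw [← core_map_le_core_map_iff Φ hΦ, Φ.apply_symm_apply, core_weak]
  right_inv N := by
    conv_rhs => rw [← core_weak N, ← Φ.apply_symm_apply (weak N)]
    apply le_antisymm <;>
    · rw [core_map_le_core_map_iff Φ hΦ, core_weak]
  map_rel_iff' {M N} := by
    change (Φ (weak M)).core ≤ (Φ (weak N)).core ↔ _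
    rw [core_map_le_core_map_iff Φ hΦ, core_weak, core_weak]

end OrderIso

end Core

/-! ### Finite-dimensional spaces over complete fields -/

section FiniteDimensional

variable {K : Type u} {X : Type w} [NontriviallyNormedField K] [CompleteSpace K] [AddCommGroup X]
  [Module K X] [FiniteDimensional K X]

/-- A linear map respects the closures of zero if and only if it descends to the separation
quotients, where it is a linear map between finite-dimensional Hausdorff spaces, hence
continuous. -/
theorem _root_.LinearMap.continuous_of_inseparable_zero {A B : Type*} [AddCommGroup A] [Module K A]
    [FiniteDimensional K A] [TopologicalSpace A] [IsTopologicalAddGroup A] [ContinuousSMul K A]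
    [AddCommGroup B] [Module K B] [TopologicalSpace B] [IsTopologicalAddGroup B]
    [ContinuousSMul K B] (f : A →ₗ[K] B) (hf : ∀ a, Inseparable a 0 → Inseparable (f a) 0) :
    Continuous f := by
  let g : SeparationQuotient A →ₗ[K] SeparationQuotient B :=
    (SeparationQuotient.mkCLM K B).toLinearMap ∘ₗ f ∘ₗ (SeparationQuotient.outCLM K A).toLinearMap
  have hg : Continuous g := g.continuous_of_finiteDimensional
  rw [SeparationQuotient.isInducing_mk.continuous_iff]
  convert hg.comp SeparationQuotient.continuous_mk using 1
  ext a
  have h : Inseparable (a - SeparationQuotient.outCLM K A (SeparationQuotient.mk a)) 0 := by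
    rw [← SeparationQuotient.mk_eq_mk, SeparationQuotient.mk_sub,
      SeparationQuotient.mk_outCLM, sub_self, SeparationQuotient.mk_zero]
  have h' := hf _ h
  rw [← SeparationQuotient.mk_eq_mk, map_sub, SeparationQuotient.mk_sub,
    SeparationQuotient.mk_zero, sub_eq_zero] at h'
  exact h'

theorem le_of_core_le {S T : VectorTopology K X} (h : S.core ≤ T.core) : T ≤ S := by
  have hins : ∀ (R : VectorTopology K X) (x : X),
      @Inseparable X R.topology x 0 ↔ x ∈ R.core := fun R x => by
    let := R.topology
    have := R.isTopologicalAddGroup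
    rw [← specializes_iff_inseparable, specializes_iff_pure, mem_core]
  have hc : Continuous[S.topology, T.topology] (LinearMap.id : X →ₗ[K] X) :=
    @LinearMap.continuous_of_inseparable_zero K _ _ X X _ _ _ S.topology S.isTopologicalAddGroup
      S.continuousSMul _ _ T.topology T.isTopologicalAddGroup T.continuousSMul LinearMap.id
      fun x hx => (hins T x).2 (h ((hins S x).1 hx))
  exact continuous_id_iff_le.1 hc

variable (K X) in
/-- Over a complete nontrivially normed field, a vector topology on a finite-dimensional space is
determined by the closure of zero. -/
noncomputable def coreOrderIso : VectorTopology K X ≃o (Submodule K X)ᵒᵈ where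
  toFun T := OrderDual.toDual T.core
  invFun M := weak (OrderDual.ofDual M)
  left_inv _ := le_antisymm (le_of_core_le (core_weak _).ge) (le_of_core_le (core_weak _).le)
  right_inv M := core_weak (OrderDual.ofDual M)
  map_rel_iff' := ⟨le_of_core_le, core_anti⟩

theorem mem_hausdorff_iff_coreOrderIso {T : VectorTopology K X} :
    T ∈ hausdorff K X ↔ coreOrderIso K X T = ⊤ :=
  mem_hausdorff_iff

end FiniteDimensional

/-- A field isomorphism between complete nontrivially normed fields, however discontinuous,
gives an isomorphism of the lattices of vector topologies in finite dimension. -/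
theorem exists_orderIso_of_ringEquiv {K : Type u} {L : Type v} [NontriviallyNormedField K]
    [CompleteSpace K] [NontriviallyNormedField L] [CompleteSpace L] (e : K ≃+* L) (n : ℕ) :
    ∃ Φ : VectorTopology K (Fin n → K) ≃o VectorTopology L (Fin n → L),
      Φ '' hausdorff K (Fin n → K) = hausdorff L (Fin n → L) := by
  let := RingHomInvPair.of_ringEquiv e
  let := RingHomInvPair.of_ringEquiv_symm e
  let s : (Fin n → K) ≃ₛₗ[(e : K →+* L)] (Fin n → L) :=
    { toFun := fun x i => e (x i)
      invFun := fun y i => e.symm (y i)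
      left_inv := fun x => by simp
      right_inv := fun y => by simp
      map_add' := fun x y => by ext i; simp
      map_smul' := fun c x => by ext i; simp }
  let Φ : VectorTopology K (Fin n → K) ≃o VectorTopology L (Fin n → L) :=
    (coreOrderIso K _).trans ((Submodule.orderIsoMapComap s).dual.trans (coreOrderIso L _).symm)
  refine ⟨Φ, ?_⟩
  ext T
  rw [Φ.image_eq_preimage_symm, Set.mem_preimage, mem_hausdorff_iff_coreOrderIso,
    mem_hausdorff_iff_coreOrderIso]
  obtain ⟨S, rfl⟩ := Φ.surjective T
  rw [Φ.symm_apply_apply]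
  simp [Φ]

end VectorTopology

/-! ### Complex numbers and `p`-adic complex numbers -/

section

open Cardinal

/-- Every point is the limit of a sequence from the dense range. -/
theorem Cardinal.mk_le_power_aleph0_of_denseRange {α β : Type u} [TopologicalSpace β]
    [FrechetUrysohnSpace β] [T2Space β] {f : α → β} (hf : DenseRange f) : #β ≤ #α ^ ℵ₀ := by
  have h : ∀ y, ∃ s : ℕ → α, Filter.Tendsto (fun n => f (s n)) Filter.atTop (𝓝 y) := fun y => by
    obtain ⟨x, hx, hlim⟩ := mem_closure_iff_seq_limit.1 (hf y)
    choose s hs using hx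
    exact ⟨s, by simpa only [hs] using hlim⟩
  choose s hs using h
  have hinj : Function.Injective s := fun y y' hyy =>
    tendsto_nhds_unique (hs y) (hyy ▸ hs y')
  simpa using mk_le_of_injective hinj

theorem PadicComplex.cardinalMk_eq_continuum (p : ℕ) [Fact p.Prime] : #ℂ_[p] = 𝔠 := by
  have h₁ : #ℚ_[p] ≤ 𝔠 := by
    simpa using Cardinal.mk_le_power_aleph0_of_denseRange (Padic.denseRange_ratCast p)
  have h₂ : #(PadicAlgCl p) ≤ 𝔠 :=
    (Algebra.IsAlgebraic.cardinalMk_le_max ℚ_[p] (PadicAlgCl p)).trans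
      (max_le h₁ aleph0_le_continuum)
  refine le_antisymm ?_ (continuum_le_cardinal_of_nontriviallyNormedField _)
  refine (Cardinal.mk_le_power_aleph0_of_denseRange
    (UniformSpace.Completion.denseRange_coe (α := PadicAlgCl p))).trans ?_
  exact (power_le_power_right h₂).trans continuum_power_aleph0.le

theorem PadicComplex.nonempty_ringEquiv_complex (p : ℕ) [Fact p.Prime] :
    Nonempty (ℂ ≃+* ℂ_[p]) :=
  IsAlgClosed.ringEquiv_of_equiv_of_charZero (by rw [mk_complex]; exact aleph0_lt_continuum)
    (Cardinal.eq.1 (by rw [mk_complex, PadicComplex.cardinalMk_eq_continuum]))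

/-- The complex numbers are connected, whereas the `p`-adic ones are totally disconnected. -/
theorem PadicComplex.isEmpty_homeomorph_complex (p : ℕ) [Fact p.Prime] :
    IsEmpty (ℂ ≃ₜ ℂ_[p]) := by
  refine ⟨fun h => ?_⟩
  have : PreconnectedSpace ℂ_[p] := h.surjective.denseRange.preconnectedSpace h.continuous
  have : Subsingleton ℂ_[p] := subsingleton_of_preconnected_totallyDisconnected
  exact zero_ne_one (Subsingleton.elim (0 : ℂ_[p]) 1)

end

theorem theorem4p2 :
    (∀ (K : Type u) (L : Type v) (X : Type w) (Y : Type z)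
      [Field K] [TopologicalSpace K] [IsTopologicalDivisionRing K] [T2Space K]
      [Field L] [TopologicalSpace L] [IsTopologicalDivisionRing L] [T2Space L]
      [AddCommGroup X] [Module K X] [AddCommGroup Y] [Module L Y],
      3 ≤ Module.rank K X →
      ∀ Φ : VectorTopology K X ≃o VectorTopology L Y,
        Φ '' VectorTopology.hausdorff K X = VectorTopology.hausdorff L Y →
        Nonempty (K ≃+* L) ∧
          Cardinal.lift.{z} (Module.rank K X) = Cardinal.lift.{w} (Module.rank L Y)) ∧
    -- "not necessarily as topological fields"
    (∃ (K L X Y : Type)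
      (_ : Field K) (_ : TopologicalSpace K) (_ : IsTopologicalDivisionRing K) (_ : T2Space K)
      (_ : Field L) (_ : TopologicalSpace L) (_ : IsTopologicalDivisionRing L) (_ : T2Space L)
      (_ : AddCommGroup X) (_ : Module K X) (_ : AddCommGroup Y) (_ : Module L Y)
      (Φ : VectorTopology K X ≃o VectorTopology L Y),
      3 ≤ Module.rank K X ∧
      Φ '' VectorTopology.hausdorff K X = VectorTopology.hausdorff L Y ∧
      ¬ ∃ e : K ≃+* L, IsHomeomorph e) := by
  refine ⟨fun K L X Y _ _ _ _ _ _ _ _ _ _ _ _ h3 Φ hΦ => ?_, ?_⟩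
  · let φ := VectorTopology.submoduleOrderIso Φ hΦ
    exact ⟨Submodule.nonempty_ringEquiv_of_orderIso_of_three_le_rank φ h3,
      Submodule.lift_rank_eq_of_orderIso φ⟩
  · obtain ⟨e⟩ := PadicComplex.nonempty_ringEquiv_complex 2
    obtain ⟨Φ, hΦ⟩ := VectorTopology.exists_orderIso_of_ringEquiv e 3
    refine ⟨ℂ, ℂ_[2], Fin 3 → ℂ, Fin 3 → ℂ_[2], inferInstance, inferInstance, inferInstance,
      inferInstance, inferInstance, inferInstance, inferInstance, inferInstance, inferInstance,
      inferInstance, inferInstance, inferInstance, Φ, ?_, hΦ, ?_⟩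
    · simp
    · rintro ⟨e', he'⟩
      exact (PadicComplex.isEmpty_homeomorph_complex 2).false he'.homeomorph
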